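/- Let $G=(V,E)$ be a finite simple graph. Its vertices represent non-colluding servers and its edges represent files; the file $W_e$ is stored exactly on the two servers that are endpoints of $e$. The files are independent and uniformly distributed on $\mathbb F_q^L$, where $\mathbb F_q$ is a finite field and $L\ge 1$; entropies $H$ are taken to base $q$, so $H(W_e)=L$. For every desired file $\theta\in E$ the user draws queries $(Q_v)_{v\in V}$ from a discrete distribution depending on $\theta$, independently of the files, and server $v$ returns an answer $A_v$ that is a deterministic function of $Q_v$ and of the files $\mathcal W_v$ stored on $v$. This is a *PIR scheme* on $G$ if it is reliable, that is, $H(W_\theta\mid (A_v)_{v\in V},(Q_v)_{v\in V})=0$ for every $\theta$, and private, that is, for every server $v$ the joint distribution of $(Q_v,A_v,\mathcal W_v)$ does not depend on $\theta$. The *capacity* $\mathcal C(G)$ is the supremum, over all PIR schemes on $G$ (all $q$ and $L$, with arbitrary, not necessarily linear, answer functions), of the rate $$\frac{L}{\sum_{v\in V}H(A_v)}.$$ Let $\mathcal C'(G)$ be the same supremum for the query-conditioned rate $L/\sum_{v\in V}H(A_v\mid Q_v)$. **Theorem.** For every even integer $N\ge 4$, both $\mathcal C(K_{N/2,N/2})$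 and $\mathcal C'(K_{N/2,N/2})$ are at most $$\frac{1}{\sum_{i=1}^{N/2}\frac{1}{i!\,2^i}}\cdot\frac1N ,$$ and this number is strictly smaller than the earlier bound $\frac 2N$. Moreover, $$\lim_{m\to\infty}\frac{1}{\sum_{i=1}^{m}\frac1{i!\,2^i}}=\frac1{e^{1/2}-1},\qquad \left|\frac1{e^{1/2}-1}-1.5415\right|<5\cdot10^{-5},$$ so the bound is asymptotically about $1.5415/N$. -/

import Mathlib

open Filter Topology
open scoped ENNReal Nat

namespace PIR

noncomputable section

/-! Shannon entropy of discrete random variables on a discrete probability space `(Ω, p)`,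
with values in `[0, ∞]` and logarithms to the base `b`. -/

/-- `H(X) = ∑ₓ P(X = x) log_b (1 / P(X = x))`. -/
def entropy {Ω α : Type} (b : ℝ) (p : PMF Ω) (X : Ω → α) : ℝ≥0∞ :=
  ∑' x : α, ENNReal.ofReal
    ((p.map X x).toReal * Real.logb b (1 / (p.map X x).toReal))

/-- `H(X | Y) = ∑_{x, y} P(X = x, Y = y) log_b (P(Y = y) / P(X = x, Y = y))`. -/
def condEntropy {Ω α β : Type} (b : ℝ) (p : PMF Ω) (X : Ω → α) (Y : Ω → β) : ℝ≥0∞ :=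
  ∑' z : α × β, ENNReal.ofReal
    ((p.map (fun ω => (X ω, Y ω)) z).toReal *
      Real.logb b ((p.map Y z.2).toReal / (p.map (fun ω => (X ω, Y ω)) z).toReal))

variable {V : Type}

/-- The data of a retrieval protocol on the graph-based replication system given by `G`: the
vertices are the servers, each edge is a file, and a file is stored on the two endpoints of its
edge. Every file consists of `L` sub-files, each a symbol of the finite field `F`. For every
desired file `θ` there is a random tuple of queries, one for each server; each server answers by a
deterministic function of its own query and of the files it stores. -/
structure Protocol (G : SimpleGraph V) where
  /-- the finite field of symbols -/
  F : Type
  [instField : Field F]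
  [instFinite : Finite F]
  /-- the number of sub-files (symbols) of each file -/
  L : ℕ
  L_pos : 0 < L
  /-- the alphabet of queries to each server -/
  Query : V → Type
  /-- the alphabet of answers of each server -/
  Answer : V → Type
  /-- the joint law of the queries when the file `θ` is wanted -/
  queryLaw : G.edgeSet → PMF ((v : V) → Query v)
  /-- the answer of the server `v` to a query, given the contents of the files stored on `v` -/
  answer : (v : V) → Query v → ({e : G.edgeSet // v ∈ e.1} → Fin L → F) → Answer v

attribute [instance] Protocol.instField Protocol.instFinite

namespace Protocol

variable {G : SimpleGraph V} (P : Protocol G)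

/-- The contents of all files. -/
abbrev Files : Type := G.edgeSet → Fin P.L → P.F

/-- An outcome: all queries, together with the contents of all files. -/
abbrev Outcome : Type := ((v : V) → P.Query v) × P.Files

/-- The law of the files: independent, each uniform on `F ^ L`. -/
def filesLaw [Finite V] : PMF P.Files :=
  letI : Fintype P.Files := Fintype.ofFinite _
  PMF.uniformOfFintype P.Files

/-- The joint law of queries and files when the file `θ` is wanted: the queries are independent
of the files. -/
def law [Finite V] (θ : G.edgeSet) : PMF P.Outcome :=
  (P.queryLaw θ).bind fun q => P.filesLaw.map fun w => (q, w)

/-- `W_e`. -/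
def file (e : G.edgeSet) (ω : P.Outcome) : Fin P.L → P.F := ω.2 e

/-- The files stored on the server `v`. -/
def stored (v : V) (ω : P.Outcome) : {e : G.edgeSet // v ∈ e.1} → Fin P.L → P.F :=
  fun e => ω.2 e.1

/-- `Q_v`. -/
def query (v : V) (ω : P.Outcome) : P.Query v := ω.1 v

/-- The tuple of all queries. -/
def queries (ω : P.Outcome) : (v : V) → P.Query v := ω.1

/-- `A_v`. -/
def ans (v : V) (ω : P.Outcome) : P.Answer v := P.answer v (P.query v ω) (P.stored v ω)

/-- The tuple of all answers. -/
def answers (ω : P.Outcome) : (v : V) → P.Answer v := fun v => P.ans v ω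

/-- The number of symbols, as the base of logarithms: entropies are measured in `F`-symbols, so
that each file has entropy `L`. -/
def base : ℝ := (Nat.card P.F : ℝ)

/-- `H(W_θ | A_1, …, A_N, Q_1, …, Q_N) = 0` whenever `θ` is the wanted file. -/
def Reliable [Finite V] : Prop :=
  ∀ θ : G.edgeSet,
    condEntropy P.base (P.law θ) (P.file θ) (fun ω => (P.answers ω, P.queries ω)) = 0

/-- For every server, the joint law of its query, its answer and its files does not depend on the
wanted file. -/
def Private [Finite V] : Prop :=
  ∀ (v : V) (θ θ' : G.edgeSet),
    (P.law θ).map (fun ω => (P.query v ω, P.ans v ω, P.stored v ω)) =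
      (P.law θ').map (fun ω => (P.query v ω, P.ans v ω, P.stored v ω))

/-- The retrieval rate `L / ∑ᵥ H(A_v)`; for a private protocol it does not depend on `θ`. -/
def rate [Fintype V] (θ : G.edgeSet) : ℝ≥0∞ :=
  (P.L : ℝ≥0∞) / ∑ v : V, entropy P.base (P.law θ) (P.ans v)

/-- The retrieval rate `L / ∑ᵥ H(A_v | Q_v)`, conditioned on the queries; for a private protocol it
does not depend on `θ`. -/
def condRate [Fintype V] (θ : G.edgeSet) : ℝ≥0∞ :=
  (P.L : ℝ≥0∞) / ∑ v : V, condEntropy P.base (P.law θ) (P.ans v) (P.query v)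

end Protocol

/-- A PIR scheme: a protocol that is reliable and private. -/
structure Scheme [Finite V] (G : SimpleGraph V) extends Protocol G where
  reliable : toProtocol.Reliable
  isPrivate : toProtocol.Private

/-- The PIR capacity of `G`: the supremum of the retrieval rates `L / ∑ᵥ H(A_v)` of all PIR schemes
on `G`. -/
def capacity [Fintype V] (G : SimpleGraph V) : ℝ≥0∞ :=
  ⨆ (S : Scheme G) (θ : G.edgeSet), S.rate θ

/-- The PIR capacity of `G` for the rates `L / ∑ᵥ H(A_v | Q_v)` conditioned on the queries. -/
def condCapacity [Fintype V] (G : SimpleGraph V) : ℝ≥0∞ :=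
  ⨆ (S : Scheme G) (θ : G.edgeSet), S.condRate θ

end

end PIR

/-! Fix a query tuple that occurs for the wanted file θ. The answers are then functions of uniform
independent files, so the entropies of files and answers form a polymatroid
(`Protocol.polymatroid`). Only four properties are used: monotonicity, submodularity, independence
of files, and each answer being a function of its server's files.

Put m = N/2, order the two sides as a₀, …, a_{m-1} and b₀, …, b_{m-1}, and let θ be the file of a_k
and b_k. Condition on all files outside the square of servers with indices ≤ k. The answers of that
square decode θ, so their entropies, each with k+1 unknown files, sum to at least L plus the joint
entropy given θ as well. The latter is bounded below by peeling off a_k, b_k, a_{k-1}, b_{k-1}, …,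
all files of a server being revealed once its answer is counted. Knowledge of θ leaves a_k and b_k
with k unknown files each; for i < k, a_i is reached with i+1 unknown files and b_i with i. This is
`grid_inequality`.

Each term concerns one server and its own query, whose law is the same for every θ by privacy. The
inequalities for different k and different orderings can therefore be averaged together
(`mean_grid_inequality`, `le_sum_of_perm_inequalities`). If F(j) is the mean answer entropy with j
unknown files, then L + ∑_{i<k} (F(i+1) + F(i)) + 2 F(k) ≤ 2(k+1) F(k+1). Equality holds for F(k) =
L ∑_{i=1}^{k} 1/(i! 2^i), and induction gives this as a lower bound. At k = m no file is known, and
the 2m servers together send at least 2m F(m). -/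

namespace PIR

/-! ### Entropy of partitions of a finite uniform space -/

section UniformEntropy

variable {Ω : Type} [Fintype Ω]

open Classical in
/-- The number of points related to `ω`. -/
noncomputable def fiberCard (R : Ω → Ω → Prop) (ω : Ω) : ℝ :=
  ((Finset.univ.filter (R ω)).card : ℝ)

/-- The entropy of the partition of a finite uniform probability space given by the classes of an
equivalence relation. -/
noncomputable def relEntropy (b : ℝ) (R : Ω → Ω → Prop) : ℝ :=
  (∑ ω, Real.logb b (Fintype.card Ω / fiberCard R ω)) / Fintype.card Ω

/-- The relation of having equal values under all members of a subfamily. -/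
def agree {ι : Type} {α : ι → Type} (Y : (i : ι) → Ω → α i) (S : Set ι) (ω ω' : Ω) : Prop :=
  ∀ i ∈ S, Y i ω' = Y i ω

theorem fiberCard_pos {R : Ω → Ω → Prop} {ω : Ω} (h : R ω ω) : 0 < fiberCard R ω := by
  classical
  unfold fiberCard
  exact_mod_cast Finset.card_pos.2 ⟨ω, by simpa using h⟩

theorem fiberCard_mono {R R' : Ω → Ω → Prop} {ω : Ω} (h : ∀ ω', R ω ω' → R' ω ω') :
    fiberCard R ω ≤ fiberCard R' ω := by
  classical
  unfold fiberCard
  exact_mod_cast Finset.card_le_card (Finset.monotone_filter_right _ fun ω' _ => h ω')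

theorem fiberCard_congr {R : Ω → Ω → Prop} {ω ω' : Ω} (h : ∀ x, R ω x ↔ R ω' x) :
    fiberCard R ω = fiberCard R ω' := by
  unfold fiberCard
  rw [show R ω = R ω' from funext fun x => propext (h x)]

theorem fiberCard_le (R : Ω → Ω → Prop) (ω : Ω) : fiberCard R ω ≤ Fintype.card Ω := by
  classical
  unfold fiberCard
  exact_mod_cast Finset.card_le_univ _

variable {ι : Type} {α : ι → Type} (Y : (i : ι) → Ω → α i)

omit [Fintype Ω] in
theorem agree_refl (S : Set ι) (ω : Ω) : agree Y S ω ω := fun _ _ => rfl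

omit [Fintype Ω] in
theorem agree_congr {S : Set ι} {ω ω' : Ω} (h : agree Y S ω ω') (x : Ω) :
    agree Y S ω x ↔ agree Y S ω' x :=
  ⟨fun g i hi => (g i hi).trans (h i hi).symm, fun g i hi => (g i hi).trans (h i hi)⟩

theorem fiberCard_agree_pos (S : Set ι) (ω : Ω) : 0 < fiberCard (agree Y S) ω :=
  fiberCard_pos (agree_refl Y S ω)

theorem relEntropy_agree_mono {b : ℝ} (hb : 1 < b) {S T : Set ι} (h : S ⊆ T) :
    relEntropy b (agree Y S) ≤ relEntropy b (agree Y T) := by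
  unfold relEntropy
  refine div_le_div_of_nonneg_right (Finset.sum_le_sum fun ω _ => ?_) (by positivity)
  have h1 := fiberCard_agree_pos Y S ω
  have h2 := fiberCard_agree_pos Y T ω
  have h3 : (0 : ℝ) < Fintype.card Ω := h1.trans_le (fiberCard_le _ _)
  refine Real.logb_le_logb_of_le hb (by positivity) ?_
  exact div_le_div_of_nonneg_left h3.le h2 (fiberCard_mono fun ω' g i hi => g i (h hi))

/-- The sum counts triples (ω, ω₁, ω₂) with ω₁ in the S-class and ω₂ in the T-class of ω, weighted
by `c ω`. For given ω₁, ω₂ the admissible ω lie in one class of `S ∪ T`, and ω₁, ω₂ must agree on `S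
∩ T`. Summing over ω and then over ω₂ cancels both factors of the weight, leaving at most 1 for each
ω₁. -/
theorem sum_fiberCard_ratio_le (S T : Set ι) :
    ∑ ω, fiberCard (agree Y S) ω * fiberCard (agree Y T) ω /
      (fiberCard (agree Y (S ∪ T)) ω * fiberCard (agree Y (S ∩ T)) ω) ≤ Fintype.card Ω := by
  classical
  set c : Ω → ℝ := fun ω =>
    (fiberCard (agree Y (S ∪ T)) ω * fiberCard (agree Y (S ∩ T)) ω)⁻¹ with hc
  have e1 : ∀ (R : Set ι) (ω : Ω), fiberCard (agree Y R) ω = ∑ x, if agree Y R ω x then 1 else 0 := by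
    intro R ω
    simp [fiberCard]
  have hinner : ∀ ω₁ ω₂ : Ω,
      ∑ ω, (if agree Y S ω ω₁ ∧ agree Y T ω ω₂ then c ω else 0) ≤
        if agree Y (S ∩ T) ω₁ ω₂ then (fiberCard (agree Y (S ∩ T)) ω₁)⁻¹ else 0 := by
    intro ω₁ ω₂
    by_cases hex : ∃ ω₀, agree Y S ω₀ ω₁ ∧ agree Y T ω₀ ω₂
    · obtain ⟨ω₀, hS, hT⟩ := hex
      have h12 : agree Y (S ∩ T) ω₁ ω₂ := fun i hi => (hT i hi.2).trans (hS i hi.1).symm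
      rw [if_pos h12]
      calc ∑ ω, (if agree Y S ω ω₁ ∧ agree Y T ω ω₂ then c ω else 0)
          ≤ ∑ ω, (if agree Y (S ∪ T) ω₀ ω then 1 else 0) *
              ((fiberCard (agree Y (S ∪ T)) ω₀)⁻¹ * (fiberCard (agree Y (S ∩ T)) ω₁)⁻¹) := by
            refine Finset.sum_le_sum fun ω _ => ?_
            split_ifs with h1 h2 h2
            · rw [one_mul, hc]
              dsimp only
              rw [mul_inv, fiberCard_congr (agree_congr Y h2)]
              have : agree Y (S ∩ T) ω ω₁ := fun i hi => h1.1 i hi.1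
              rw [fiberCard_congr (agree_congr Y this)]
            · exact absurd (fun i hi => by
                rcases hi with hi | hi
                · exact (h1.1 i hi).symm.trans (hS i hi)
                · exact (h1.2 i hi).symm.trans (hT i hi)) h2
            · have := fiberCard_agree_pos Y (S ∪ T) ω₀
              have := fiberCard_agree_pos Y (S ∩ T) ω₁
              positivity
            · simp
        _ = (fiberCard (agree Y (S ∩ T)) ω₁)⁻¹ := by
            rw [← Finset.sum_mul, ← e1, mul_inv_cancel_left₀ (fiberCard_agree_pos Y _ _).ne']
    · rw [Finset.sum_eq_zero fun ω _ => if_neg fun h => hex ⟨ω, h⟩]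
      have := fiberCard_agree_pos Y (S ∩ T) ω₁
      split_ifs <;> positivity
  calc ∑ ω, fiberCard (agree Y S) ω * fiberCard (agree Y T) ω /
        (fiberCard (agree Y (S ∪ T)) ω * fiberCard (agree Y (S ∩ T)) ω)
      = ∑ ω, ∑ ω₁, ∑ ω₂, (if agree Y S ω ω₁ ∧ agree Y T ω ω₂ then c ω else 0) := by
        refine Finset.sum_congr rfl fun ω _ => ?_
        rw [e1 S, e1 T, Finset.sum_mul_sum, div_eq_mul_inv, Finset.sum_mul]
        refine Finset.sum_congr rfl fun ω₁ _ => ?_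
        rw [Finset.sum_mul]
        refine Finset.sum_congr rfl fun ω₂ _ => ?_
        by_cases h1 : agree Y S ω ω₁ <;> by_cases h2 : agree Y T ω ω₂ <;> simp [h1, h2, hc]
    _ = ∑ ω₁, ∑ ω₂, ∑ ω, (if agree Y S ω ω₁ ∧ agree Y T ω ω₂ then c ω else 0) := by
        rw [Finset.sum_comm]
        exact Finset.sum_congr rfl fun ω₁ _ => Finset.sum_comm
    _ ≤ ∑ ω₁, ∑ ω₂,
          (if agree Y (S ∩ T) ω₁ ω₂ then (fiberCard (agree Y (S ∩ T)) ω₁)⁻¹ else 0) :=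
        Finset.sum_le_sum fun ω₁ _ => Finset.sum_le_sum fun ω₂ _ => hinner ω₁ ω₂
    _ = ∑ ω₁ : Ω, (1 : ℝ) := by
        refine Finset.sum_congr rfl fun ω₁ _ => ?_
        have : ∀ ω₂, (if agree Y (S ∩ T) ω₁ ω₂ then (fiberCard (agree Y (S ∩ T)) ω₁)⁻¹ else 0) =
            (if agree Y (S ∩ T) ω₁ ω₂ then 1 else 0) * (fiberCard (agree Y (S ∩ T)) ω₁)⁻¹ := by
          intro ω₂
          split_ifs <;> simp
        rw [Finset.sum_congr rfl fun ω₂ _ => this ω₂, ← Finset.sum_mul, ← e1,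
          mul_inv_cancel₀ (fiberCard_agree_pos Y _ _).ne']
    _ = Fintype.card Ω := by simp

/-- The defect is a sum of logarithms of the ratios in `sum_fiberCard_ratio_le`; log t ≤ t - 1
reduces the claim to that count. -/
theorem relEntropy_agree_submodular {b : ℝ} (hb : 1 < b) (S T : Set ι) :
    relEntropy b (agree Y (S ∪ T)) + relEntropy b (agree Y (S ∩ T)) ≤
      relEntropy b (agree Y S) + relEntropy b (agree Y T) := by
  unfold relEntropy
  rw [← add_div, ← add_div, ← Finset.sum_add_distrib, ← Finset.sum_add_distrib]
  refine div_le_div_of_nonneg_right ?_ (by positivity)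
  rw [← sub_nonpos, ← Finset.sum_sub_distrib]
  have hlog : 0 < Real.log b := Real.log_pos hb
  have key : ∀ ω, Real.logb b (Fintype.card Ω / fiberCard (agree Y (S ∪ T)) ω) +
      Real.logb b (Fintype.card Ω / fiberCard (agree Y (S ∩ T)) ω) -
      (Real.logb b (Fintype.card Ω / fiberCard (agree Y S) ω) +
        Real.logb b (Fintype.card Ω / fiberCard (agree Y T) ω)) ≤
      (fiberCard (agree Y S) ω * fiberCard (agree Y T) ω /
      (fiberCard (agree Y (S ∪ T)) ω * fiberCard (agree Y (S ∩ T)) ω) - 1) / Real.log b := by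
    intro ω
    have h1 := fiberCard_agree_pos Y S ω
    have h2 := fiberCard_agree_pos Y T ω
    have h3 := fiberCard_agree_pos Y (S ∪ T) ω
    have h4 := fiberCard_agree_pos Y (S ∩ T) ω
    have h5 : (0 : ℝ) < Fintype.card Ω := h1.trans_le (fiberCard_le _ _)
    have := Real.log_le_sub_one_of_pos (show 0 < fiberCard (agree Y S) ω * fiberCard (agree Y T) ω /
      (fiberCard (agree Y (S ∪ T)) ω * fiberCard (agree Y (S ∩ T)) ω) by positivity)
    rw [Real.log_div (by positivity) (by positivity), Real.log_mul h1.ne' h2.ne',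
      Real.log_mul h3.ne' h4.ne'] at this
    simp only [Real.logb]
    rw [Real.log_div h5.ne' h1.ne', Real.log_div h5.ne' h2.ne', Real.log_div h5.ne' h3.ne',
      Real.log_div h5.ne' h4.ne', ← add_div, ← add_div, ← sub_div]
    refine div_le_div_of_nonneg_right ?_ hlog.le
    linarith
  refine (Finset.sum_le_sum fun ω _ => key ω).trans ?_
  rw [← Finset.sum_div, Finset.sum_sub_distrib]
  refine div_nonpos_of_nonpos_of_nonneg ?_ hlog.le
  have := sum_fiberCard_ratio_le Y S T
  simp only [Finset.sum_const, Finset.card_univ, nsmul_eq_mul, mul_one]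
  linarith

end UniformEntropy

/-! ### Entropy of a set of independent uniform coordinates -/

section FreeCoordinates

variable {E X : Type} [Finite E] [Fintype X] [Nonempty X] [Fintype (E → X)]

omit [Nonempty X] in
theorem fiberCard_eqOn (U : Set E) (w : E → X) :
    fiberCard (fun w w' : E → X => ∀ e ∈ U, w' e = w e) w =
      (Fintype.card X : ℝ) ^ (Uᶜ.ncard) := by
  classical
  have := Fintype.ofFinite E
  unfold fiberCard
  have hc : ∀ e, ((if e ∈ U then {w e} else Finset.univ : Finset X)).card =
      if e ∈ U then 1 else Fintype.card X := by
    intro e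
    split_ifs <;> simp
  have key : (((Fintype.piFinset fun e => if e ∈ U then {w e} else Finset.univ).card : ℕ) : ℝ) =
      (Fintype.card X : ℝ) ^ (Uᶜ.ncard) := by
    rw [Fintype.card_piFinset, Finset.prod_congr rfl fun e _ => hc e, Finset.prod_ite,
      Finset.prod_const_one, one_mul, Finset.prod_const, Set.ncard_eq_toFinset_card']
    push_cast
    congr 2
    ext e
    simp
  refine Eq.trans (congrArg _ (congrArg Finset.card ?_)) key
  ext w'
  simp only [Finset.mem_filter, Finset.mem_univ, true_and, Fintype.mem_piFinset]
  refine forall_congr' fun e => ?_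
  by_cases he : e ∈ U <;> simp [he]

theorem relEntropy_eqOn {b : ℝ} (U : Set E) :
    relEntropy b (fun w w' : E → X => ∀ e ∈ U, w' e = w e) =
      Real.logb b (Fintype.card X) * U.ncard := by
  have hX : (0 : ℝ) < Fintype.card X := by exact_mod_cast Fintype.card_pos
  have hcard : (Fintype.card (E → X) : ℝ) = (Fintype.card X : ℝ) ^ (Nat.card E) := by
    rw [← Nat.card_eq_fintype_card, Nat.card_fun, Nat.card_eq_fintype_card]
    push_cast
    rfl
  unfold relEntropy
  simp only [fiberCard_eqOn]
  rw [Finset.sum_const, nsmul_eq_mul, Finset.card_univ, hcard, mul_div_cancel_left₀ _ (by positivity),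
    ← Set.ncard_add_ncard_compl U, pow_add, mul_div_cancel_right₀ _ (by positivity),
    Real.logb_pow, mul_comm]

end FreeCoordinates

/-! ### Polymatroids of files and answers -/

/-- A polymatroid rank function on files `E` and answers `V` in which files are independent, each
of rank `L`, and the answer `v` is a function of the files in `inc v`. -/
structure StoragePolymatroid {E V : Type} (inc : V → Set E) (L : ℝ) where
  /-- the rank function -/
  rank : Set (E ⊕ V) → ℝ
  mono : ∀ {S T}, S ⊆ T → rank S ≤ rank T
  submodular : ∀ S T, rank (S ∪ T) + rank (S ∩ T) ≤ rank S + rank T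
  rank_files : ∀ U : Set E, rank (Sum.inl '' U) = L * U.ncard
  determined : ∀ {S T}, S ⊆ T →
    (∀ x ∈ T, x ∈ S ∨ ∃ v, x = Sum.inr v ∧ Sum.inl '' inc v ⊆ S) → rank T = rank S

namespace StoragePolymatroid

variable {E V : Type} {inc : V → Set E} {L : ℝ} (M : StoragePolymatroid inc L)

/-- The rank of the answers in `T` conditioned on the files in `U`. -/
def condRank (T : Set V) (U : Set E) : ℝ :=
  M.rank (Sum.inl '' U ∪ Sum.inr '' T) - M.rank (Sum.inl '' U)

theorem condRank_nonneg (T : Set V) (U : Set E) : 0 ≤ M.condRank T U :=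
  sub_nonneg.2 (M.mono Set.subset_union_left)

theorem condRank_insert_le (v : V) (T : Set V) (U : Set E) :
    M.condRank (insert v T) U ≤ M.condRank T U + M.condRank {v} U := by
  have h := M.submodular (Sum.inl '' U ∪ Sum.inr '' T) (Sum.inl '' U ∪ Sum.inr '' {v})
  have h1 : (Sum.inl '' U ∪ Sum.inr '' T : Set (E ⊕ V)) ∪ (Sum.inl '' U ∪ Sum.inr '' {v}) =
      Sum.inl '' U ∪ Sum.inr '' (insert v T) := by
    rw [Set.insert_eq, Set.image_union]
    ext x
    simp only [Set.mem_union]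
    tauto
  have h2 := M.mono (show (Sum.inl '' U : Set (E ⊕ V)) ⊆
    (Sum.inl '' U ∪ Sum.inr '' T) ∩ (Sum.inl '' U ∪ Sum.inr '' {v}) from
    Set.subset_inter Set.subset_union_left Set.subset_union_left)
  rw [h1] at h
  unfold condRank
  linarith

/-- Chain rule for `v` followed by `T`; conditioning further on all files of `v`, which determine
its answer, can only lower the second term. -/
theorem condRank_insert_ge (v : V) (T : Set V) (U : Set E) (hv : v ∉ T) :
    M.condRank {v} U + M.condRank T (U ∪ inc v) ≤ M.condRank (insert v T) U := by
  have h := M.submodular (Sum.inl '' U ∪ Sum.inr '' (insert v T))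
    (Sum.inl '' (U ∪ inc v) ∪ Sum.inr '' {v})
  have h1 : M.rank ((Sum.inl '' U ∪ Sum.inr '' {v})) ≤
      M.rank ((Sum.inl '' U ∪ Sum.inr '' (insert v T)) ∩
        (Sum.inl '' (U ∪ inc v) ∪ Sum.inr '' {v})) := by
    refine M.mono ?_
    rintro x (⟨e, he, rfl⟩ | ⟨u, rfl, rfl⟩) <;> simp [*]
  have h2 : M.rank (Sum.inl '' (U ∪ inc v) ∪ Sum.inr '' T) ≤
      M.rank ((Sum.inl '' U ∪ Sum.inr '' (insert v T)) ∪
        (Sum.inl '' (U ∪ inc v) ∪ Sum.inr '' {v})) := by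
    refine M.mono ?_
    rintro x (⟨e, he, rfl⟩ | ⟨u, hu, rfl⟩)
    · exact Or.inr (Or.inl ⟨e, he, rfl⟩)
    · exact Or.inl (Or.inr ⟨u, Or.inr hu, rfl⟩)
  have h3 : M.rank (Sum.inl '' (U ∪ inc v) ∪ Sum.inr '' {v}) = M.rank (Sum.inl '' (U ∪ inc v)) := by
    refine M.determined Set.subset_union_left ?_
    rintro x (hx | ⟨u, rfl, rfl⟩)
    · exact Or.inl hx
    · exact Or.inr ⟨_, rfl, Set.image_mono Set.subset_union_right⟩
  unfold condRank
  linarith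

variable [Finite E]

/-- The files of `U` not stored on `v` are independent of everything `v` holds. Formally, rank is
modular on sets of files (`hcard`). -/
theorem condRank_singleton_inter (v : V) (U : Set E) :
    M.condRank {v} (U ∩ inc v) = M.condRank {v} U := by
  have hm : ∀ v : V, M.rank (Sum.inl '' inc v ∪ Sum.inr '' {v}) = M.rank (Sum.inl '' inc v) := by
    intro v
    refine M.determined Set.subset_union_left ?_
    rintro x (hx | ⟨u, rfl, rfl⟩)
    · exact Or.inl hx
    · exact Or.inr ⟨_, rfl, subset_rfl⟩
  have hcard : M.rank (Sum.inl '' (U ∪ inc v)) + M.rank (Sum.inl '' (U ∩ inc v)) =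
      M.rank (Sum.inl '' U) + M.rank (Sum.inl '' inc v) := by
    simp only [M.rank_files]
    rw [← mul_add, ← mul_add]
    congr 1
    exact_mod_cast Set.ncard_union_add_ncard_inter U (inc v)
  apply le_antisymm
  · have h := M.submodular (Sum.inl '' U ∪ Sum.inr '' {v}) (Sum.inl '' inc v ∪ Sum.inr '' {v})
    have h1 := M.mono (show (Sum.inl '' (U ∩ inc v) ∪ Sum.inr '' {v} : Set (E ⊕ V)) ⊆
        (Sum.inl '' U ∪ Sum.inr '' {v}) ∩ (Sum.inl '' inc v ∪ Sum.inr '' {v}) by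
      rintro x (⟨e, he, rfl⟩ | ⟨u, rfl, rfl⟩)
      · exact ⟨Or.inl ⟨e, he.1, rfl⟩, Or.inl ⟨e, he.2, rfl⟩⟩
      · simp)
    have h2 := M.mono (show (Sum.inl '' (U ∪ inc v) : Set (E ⊕ V)) ⊆
        (Sum.inl '' U ∪ Sum.inr '' {v}) ∪ (Sum.inl '' inc v ∪ Sum.inr '' {v}) by
      rintro x ⟨e, he | he, rfl⟩
      · exact Or.inl (Or.inl ⟨e, he, rfl⟩)
      · exact Or.inr (Or.inl ⟨e, he, rfl⟩))
    have h3 := hm v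
    unfold condRank
    linarith
  · have h := M.submodular (Sum.inl '' (U ∩ inc v) ∪ Sum.inr '' {v}) (Sum.inl '' U)
    have h1 := M.mono (show (Sum.inl '' (U ∩ inc v) : Set (E ⊕ V)) ⊆
        (Sum.inl '' (U ∩ inc v) ∪ Sum.inr '' {v}) ∩ Sum.inl '' U from
      Set.subset_inter Set.subset_union_left (Set.image_mono Set.inter_subset_left))
    have h2 := M.mono (show (Sum.inl '' U ∪ Sum.inr '' {v} : Set (E ⊕ V)) ⊆
        (Sum.inl '' (U ∩ inc v) ∪ Sum.inr '' {v}) ∪ Sum.inl '' U from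
      Set.union_subset Set.subset_union_right (Set.subset_union_right.trans Set.subset_union_left))
    unfold condRank
    linarith

theorem condRank_singleton_congr (v : V) {U U' : Set E} (h : ∀ e ∈ inc v, e ∈ U ↔ e ∈ U') :
    M.condRank {v} U = M.condRank {v} U' := by
  rw [← M.condRank_singleton_inter v U, ← M.condRank_singleton_inter v U']
  congr 1
  ext e
  exact and_congr_left fun he => h e he

/-- Servers outside `T` store only files of `U`, so the answers in `T` together with `U` give all
answers and hence θ, a new file of rank `L`. -/
theorem condRank_decode {θ : E} {T : Set V} {U : Set E}
    (hθ : ∀ S, (∀ v, Sum.inr v ∈ S) → M.rank (insert (Sum.inl θ) S) = M.rank S)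
    (hU : θ ∉ U) (hT : ∀ v, v ∉ T → inc v ⊆ U) :
    L + M.condRank T (insert θ U) ≤ M.condRank T U := by
  have h1 : M.rank (Sum.inl '' U ∪ Sum.inr '' Set.univ) = M.rank (Sum.inl '' U ∪ Sum.inr '' T) := by
    refine M.determined (Set.union_subset_union_right _ (Set.image_mono (Set.subset_univ _))) ?_
    rintro x (hx | ⟨v, -, rfl⟩)
    · exact Or.inl (Or.inl hx)
    · by_cases hv : v ∈ T
      · exact Or.inl (Or.inr ⟨v, hv, rfl⟩)
      · exact Or.inr ⟨v, rfl, (Set.image_mono (hT v hv)).trans Set.subset_union_left⟩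
  have h2 := hθ (Sum.inl '' U ∪ Sum.inr '' Set.univ) (by simp)
  have h3 := M.mono (show (Sum.inl '' (insert θ U) ∪ Sum.inr '' T : Set (E ⊕ V)) ⊆
      insert (Sum.inl θ) (Sum.inl '' U ∪ Sum.inr '' Set.univ) by
    rw [Set.image_insert_eq, Set.insert_union]
    exact Set.insert_subset_insert
      (Set.union_subset_union_right _ (Set.image_mono (Set.subset_univ _))))
  have h4 : M.rank (Sum.inl '' (insert θ U)) = M.rank (Sum.inl '' U) + L := by
    rw [M.rank_files, M.rank_files, Set.ncard_insert_of_notMem hU]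
    push_cast
    ring
  unfold condRank
  linarith

/-! ### The inequality for an ordered complete bipartite graph -/

section Grid

variable {m : ℕ} {a b : ℕ → V} {p q : E → ℕ}

/-- The servers `a i` and `b i` with `i < k`. -/
def gridServers (a b : ℕ → V) : ℕ → Set V
  | 0 => ∅
  | k + 1 => insert (a k) (insert (b k) (gridServers a b k))

omit [Finite E] in
theorem mem_gridServers {k : ℕ} {v : V} :
    v ∈ gridServers a b k ↔ ∃ i < k, v = a i ∨ v = b i := by
  induction k with
  | zero => simp [gridServers]
  | succ k ih =>
    simp only [gridServers, Set.mem_insert_iff, ih]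
    constructor
    · rintro (h | h | ⟨i, hi, h⟩)
      · exact ⟨k, by omega, Or.inl h⟩
      · exact ⟨k, by omega, Or.inr h⟩
      · exact ⟨i, by omega, h⟩
    · rintro ⟨i, hi, h⟩
      rcases Nat.lt_succ_iff_lt_or_eq.1 hi with hi | rfl
      · exact Or.inr (Or.inr ⟨i, hi, h⟩)
      · tauto

omit [Finite E] in
theorem condRank_gridServers_le (U : Set E) (k : ℕ) :
    M.condRank (gridServers a b k) U ≤
      ∑ i ∈ Finset.range k, (M.condRank {a i} U + M.condRank {b i} U) := by
  induction k with
  | zero => simp [gridServers, condRank]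
  | succ k ih =>
    rw [Finset.sum_range_succ, gridServers]
    have h1 := M.condRank_insert_le (a k) (insert (b k) (gridServers a b k)) U
    have h2 := M.condRank_insert_le (b k) (gridServers a b k) U
    linarith

/-- Peel off `a k`, reveal its files, then peel off `b k` and reveal its files: what remains is the
square of side `k`. Since `a k` goes first, it has one more unknown file than `b k`, which explains
`i + 1` against `i`. -/
theorem condRank_gridServers_ge
    (ha : ∀ i < m, inc (a i) = {e | p e = i}) (hb : ∀ i < m, inc (b i) = {e | q e = i})
    (hai : ∀ i < m, ∀ j < m, a i = a j → i = j) (hbi : ∀ i < m, ∀ j < m, b i = b j → i = j)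
    (hab : ∀ i j, a i ≠ b j) (k : ℕ) (hk : k ≤ m) :
    ∑ i ∈ Finset.range k,
        (M.condRank {a i} {e | i + 1 ≤ q e} + M.condRank {b i} {e | i ≤ p e}) ≤
      M.condRank (gridServers a b k) {e | k ≤ p e ∨ k ≤ q e} := by
  induction k with
  | zero => simpa using M.condRank_nonneg _ _
  | succ k ih =>
    have ih := ih (by omega)
    rw [Finset.sum_range_succ, gridServers]
    have hb' : b k ∉ gridServers a b k := by
      rw [mem_gridServers]
      rintro ⟨i, hi, h | h⟩
      · exact hab _ _ h.symm
      · exact absurd (hbi _ (by omega) _ (by omega) h) (by omega)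
    have ha' : a k ∉ insert (b k) (gridServers a b k) := by
      rw [Set.mem_insert_iff, mem_gridServers]
      rintro (h | ⟨i, hi, h | h⟩)
      · exact hab _ _ h
      · exact absurd (hai _ (by omega) _ (by omega) h) (by omega)
      · exact hab _ _ h
    have h1 := M.condRank_insert_ge _ _ {e | k + 1 ≤ p e ∨ k + 1 ≤ q e} ha'
    have h2 := M.condRank_insert_ge _ _ ({e | k + 1 ≤ p e ∨ k + 1 ≤ q e} ∪ inc (a k)) hb'
    have h3 : ({e | k + 1 ≤ p e ∨ k + 1 ≤ q e} ∪ inc (a k)) ∪ inc (b k) =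
        {e | k ≤ p e ∨ k ≤ q e} := by
      rw [ha k (by omega), hb k (by omega)]
      ext e
      simp only [Set.mem_union, Set.mem_ofPred_eq]
      omega
    have h4 : M.condRank {a k} {e | k + 1 ≤ p e ∨ k + 1 ≤ q e} =
        M.condRank {a k} {e | k + 1 ≤ q e} := by
      refine M.condRank_singleton_congr _ fun e he => ?_
      rw [ha k (by omega)] at he
      simp only [Set.mem_ofPred_eq] at he ⊢
      omega
    have h5 : M.condRank {b k} ({e | k + 1 ≤ p e ∨ k + 1 ≤ q e} ∪ inc (a k)) =
        M.condRank {b k} {e | k ≤ p e} := by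
      refine M.condRank_singleton_congr _ fun e he => ?_
      rw [hb k (by omega)] at he
      rw [ha k (by omega)]
      simp only [Set.mem_union, Set.mem_ofPred_eq] at he ⊢
      omega
    rw [h3] at h2
    linarith

/-- The converse inequality for a complete bipartite subgraph with the servers `a i` and `b i`,
`i ≤ k`, whose answers decode the file shared by `a k` and `b k`. -/
theorem grid_inequality
    (ha : ∀ i < m, inc (a i) = {e | p e = i}) (hb : ∀ i < m, inc (b i) = {e | q e = i})
    (hai : ∀ i < m, ∀ j < m, a i = a j → i = j) (hbi : ∀ i < m, ∀ j < m, b i = b j → i = j)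
    (hab : ∀ i j, a i ≠ b j) (hcover : ∀ v, ∃ i < m, v = a i ∨ v = b i)
    {k : ℕ} (hk : k < m) {θ : E} (hθ : ∀ e, p e = k ∧ q e = k ↔ e = θ)
    (hdec : ∀ S, (∀ v, Sum.inr v ∈ S) → M.rank (insert (Sum.inl θ) S) = M.rank S) :
    L + ∑ i ∈ Finset.range k,
        (M.condRank {a i} {e | i + 1 ≤ q e} + M.condRank {b i} {e | i ≤ p e}) +
        M.condRank {a k} {e | k ≤ q e} + M.condRank {b k} {e | k ≤ p e} ≤
      ∑ i ∈ Finset.range (k + 1),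
        (M.condRank {a i} {e | k + 1 ≤ q e} + M.condRank {b i} {e | k + 1 ≤ p e}) := by
  have hpq := (hθ θ).2 rfl
  -- Everything outside the square of side `k + 1`, whose last corner is θ.
  set U : Set E := {e | k + 1 ≤ p e ∨ k + 1 ≤ q e} with hU
  have hb' : b k ∉ gridServers a b k := by
    rw [mem_gridServers]
    rintro ⟨i, hi, h | h⟩
    · exact hab _ _ h.symm
    · exact absurd (hbi _ (by omega) _ (by omega) h) (by omega)
  have ha' : a k ∉ insert (b k) (gridServers a b k) := by
    rw [Set.mem_insert_iff, mem_gridServers]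
    rintro (h | ⟨i, hi, h | h⟩)
    · exact hab _ _ h
    · exact absurd (hai _ (by omega) _ (by omega) h) (by omega)
    · exact hab _ _ h
  have hdecode : L + M.condRank (gridServers a b (k + 1)) (insert θ U) ≤
      M.condRank (gridServers a b (k + 1)) U := by
    refine M.condRank_decode hdec ?_ ?_
    · simp only [hU, Set.mem_ofPred_eq]
      omega
    · intro v hv e he
      obtain ⟨i, hi, rfl | rfl⟩ := hcover v
      · have : ¬ i < k + 1 := fun h => hv (mem_gridServers.2 ⟨i, h, Or.inl rfl⟩)
        rw [ha i hi] at he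
        simp only [hU, Set.mem_ofPred_eq] at he ⊢
        omega
      · have : ¬ i < k + 1 := fun h => hv (mem_gridServers.2 ⟨i, h, Or.inr rfl⟩)
        rw [hb i hi] at he
        simp only [hU, Set.mem_ofPred_eq] at he ⊢
        omega
  have hmem : ∀ e, e ∈ insert θ U ↔ (p e = k ∧ q e = k) ∨ k + 1 ≤ p e ∨ k + 1 ≤ q e := by
    intro e
    rw [hθ e]
    exact Set.mem_insert_iff
  have h1 := M.condRank_insert_ge _ _ (insert θ U) ha'
  have h2 := M.condRank_insert_ge _ _ (insert θ U ∪ inc (a k)) hb'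
  have h3 : (insert θ U ∪ inc (a k)) ∪ inc (b k) = {e | k ≤ p e ∨ k ≤ q e} := by
    rw [ha k (by omega), hb k (by omega)]
    ext e
    simp only [Set.mem_union, hmem, Set.mem_ofPred_eq]
    omega
  -- The only file of `a k` that θ adds to `U` is θ itself, so `k` of its files stay unknown instead
  -- of `k + 1`.
  have h4 : M.condRank {a k} (insert θ U) = M.condRank {a k} {e | k ≤ q e} := by
    refine M.condRank_singleton_congr _ fun e he => ?_
    rw [ha k (by omega)] at he
    rw [hmem]
    simp only [Set.mem_ofPred_eq] at he ⊢
    omega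
  have h5 : M.condRank {b k} (insert θ U ∪ inc (a k)) = M.condRank {b k} {e | k ≤ p e} := by
    refine M.condRank_singleton_congr _ fun e he => ?_
    rw [hb k (by omega)] at he
    rw [ha k (by omega), Set.mem_union, hmem]
    simp only [Set.mem_ofPred_eq] at he ⊢
    omega
  have h6 := M.condRank_gridServers_ge ha hb hai hbi hab k hk.le
  have h7 := M.condRank_gridServers_le (a := a) (b := b) U (k + 1)
  have h8 : ∑ i ∈ Finset.range (k + 1), (M.condRank {a i} U + M.condRank {b i} U) =
      ∑ i ∈ Finset.range (k + 1),
        (M.condRank {a i} {e | k + 1 ≤ q e} + M.condRank {b i} {e | k + 1 ≤ p e}) := by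
    refine Finset.sum_congr rfl fun i hi => ?_
    have hi := Finset.mem_range.1 hi
    congr 1
    · refine M.condRank_singleton_congr _ fun e he => ?_
      rw [ha i (by omega)] at he
      simp only [hU, Set.mem_ofPred_eq] at he ⊢
      omega
    · refine M.condRank_singleton_congr _ fun e he => ?_
      rw [hb i (by omega)] at he
      simp only [hU, Set.mem_ofPred_eq] at he ⊢
      omega
  rw [h3] at h2
  rw [gridServers] at hdecode h7
  linarith

end Grid

end StoragePolymatroid

/-! ### Entropy of discrete random variables -/

section PMFLemmas

variable {Ω α β : Type}

theorem tsum_map_mul (p : PMF Ω) (f : Ω → α) (g : α → ℝ≥0∞) :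
    ∑' x, p.map f x * g x = ∑' ω, p ω * g (f ω) := by
  classical
  simp only [PMF.map_apply, ← ENNReal.tsum_mul_right]
  rw [ENNReal.tsum_comm]
  refine tsum_congr fun ω => ?_
  rw [tsum_eq_single (f ω) fun x hx => by simp [hx]]
  simp

theorem map_fst_apply (p : PMF Ω) (X : Ω → α) (Y : Ω → β) (x : α) :
    p.map X x = ∑' y, p.map (fun ω => (X ω, Y ω)) (x, y) := by
  classical
  have h : p.map X = (p.map fun ω => (X ω, Y ω)).map Prod.fst := by
    rw [PMF.map_comp]
    rfl
  rw [h, PMF.map_apply, ENNReal.tsum_prod', tsum_eq_single x]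
  · simp
  · intro x' hx'
    simp [hx'.symm]

theorem map_snd_apply (p : PMF Ω) (X : Ω → α) (Y : Ω → β) (y : β) :
    p.map Y y = ∑' x, p.map (fun ω => (X ω, Y ω)) (x, y) := by
  classical
  have h : p.map Y = (p.map fun ω => (X ω, Y ω)).map Prod.snd := by
    rw [PMF.map_comp]
    rfl
  rw [h, PMF.map_apply, ENNReal.tsum_prod', ENNReal.tsum_comm, tsum_eq_single y]
  · simp
  · intro y' hy'
    simp [hy'.symm]

theorem ofReal_toReal_apply (p : PMF α) (a : α) : ENNReal.ofReal (p a).toReal = p a :=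
  ENNReal.ofReal_toReal (p.apply_ne_top a)

theorem toReal_apply_le_one (p : PMF α) (a : α) : (p a).toReal ≤ 1 :=
  ENNReal.toReal_le_of_le_ofReal zero_le_one (by simpa using p.coe_le_one a)

/-- Gibbs' inequality for a single term. -/
theorem gibbs_term {u v c : ℝ} (hu : 0 ≤ u) (hv : 0 ≤ v) (hc : 0 ≤ c) (huv : u ≤ v)
    (huc : u ≤ c) : u * Real.log (v / u) + u ≤ u * Real.log (1 / c) + c * v := by
  rcases hu.eq_or_lt with rfl | hu
  · simpa using mul_nonneg hc hv
  have hv' := hu.trans_le huv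
  have hc' := hu.trans_le huc
  have h := Real.log_le_sub_one_of_pos (show 0 < c * v / u by positivity)
  rw [Real.log_div (by positivity) hu.ne', Real.log_mul hc'.ne' hv'.ne'] at h
  rw [Real.log_div hv'.ne' hu.ne', one_div, Real.log_inv]
  have h2 := mul_le_mul_of_nonneg_left h hu.le
  have h3 : u * (c * v / u - 1) = c * v - u := by
    field_simp
  nlinarith

theorem condEntropy_le_entropy {b : ℝ} (hb : 1 < b) (p : PMF Ω) (X : Ω → α) (Y : Ω → β) :
    condEntropy b p X Y ≤ entropy b p X := by
  have hlog : 0 < Real.log b := Real.log_pos hb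
  unfold condEntropy entropy
  rw [ENNReal.tsum_prod']
  refine ENNReal.tsum_le_tsum fun x => ?_
  set J := p.map fun ω => (X ω, Y ω) with hJ
  set c := (p.map X x).toReal with hc
  have hc0 : 0 ≤ c := ENNReal.toReal_nonneg
  have hc1 : c ≤ 1 := toReal_apply_le_one _ _
  have hcs : ∑' y, ENNReal.ofReal (J (x, y)).toReal = ENNReal.ofReal c := by
    simp only [ofReal_toReal_apply]
    rw [hc, ofReal_toReal_apply, map_fst_apply p X Y x]
  have hJX : ∀ y, (J (x, y)).toReal ≤ c := fun y => by
    refine ENNReal.toReal_mono (PMF.apply_ne_top _ _) ?_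
    rw [map_fst_apply p X Y x]
    exact ENNReal.le_tsum y
  have hJY : ∀ y, (J (x, y)).toReal ≤ (p.map Y y).toReal := fun y => by
    refine ENNReal.toReal_mono (PMF.apply_ne_top _ _) ?_
    rw [map_snd_apply p X Y y]
    exact ENNReal.le_tsum x
  have hlc : 0 ≤ Real.log (1 / c) := by
    rw [one_div, Real.log_inv]
    exact neg_nonneg.2 (Real.log_nonpos hc0 hc1)
  -- Both added terms sum over `y` to `c / log b`. As this is finite, it cancels even where the
  -- entropies are infinite.
  have hterm : ∀ y, ENNReal.ofReal
        ((J (x, y)).toReal * Real.logb b ((p.map Y y).toReal / (J (x, y)).toReal)) +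
        ENNReal.ofReal (J (x, y)).toReal * ENNReal.ofReal (Real.log b)⁻¹ ≤
      ENNReal.ofReal (J (x, y)).toReal * ENNReal.ofReal (Real.logb b (1 / c)) +
        ENNReal.ofReal c * ENNReal.ofReal (Real.log b)⁻¹ * p.map Y y := by
    intro y
    set u := (J (x, y)).toReal
    set v := (p.map Y y).toReal with hv
    have hu0 : 0 ≤ u := ENNReal.toReal_nonneg
    have hv0 : 0 ≤ v := ENNReal.toReal_nonneg
    have hg := gibbs_term hu0 hv0 hc0 (hJY y) (hJX y)
    have huv : 0 ≤ u * Real.logb b (v / u) := by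
      rcases hu0.eq_or_lt with h | h
      · rw [← h]
        simp
      · exact mul_nonneg hu0 (Real.logb_nonneg hb ((one_le_div h).2 (hJY y)))
    rw [← ofReal_toReal_apply (p.map Y) y, ← hv, ← ENNReal.ofReal_mul hu0, ← ENNReal.ofReal_mul hu0,
      ← ENNReal.ofReal_mul hc0, ← ENNReal.ofReal_mul (by positivity),
      ← ENNReal.ofReal_add huv (by positivity), ← ENNReal.ofReal_add
        (show 0 ≤ u * Real.logb b (1 / c) from mul_nonneg hu0 (div_nonneg hlc hlog.le))
        (by positivity)]
    refine ENNReal.ofReal_le_ofReal ?_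
    simp only [Real.logb]
    have e1 : u * (Real.log (v / u) / Real.log b) + u * (Real.log b)⁻¹ =
        (u * Real.log (v / u) + u) * (Real.log b)⁻¹ := by ring
    have e2 : u * (Real.log (1 / c) / Real.log b) + c * (Real.log b)⁻¹ * v =
        (u * Real.log (1 / c) + c * v) * (Real.log b)⁻¹ := by ring
    rw [e1, e2]
    exact mul_le_mul_of_nonneg_right hg (by positivity)
  have hsum := ENNReal.tsum_le_tsum hterm
  rw [ENNReal.tsum_add, ENNReal.tsum_add, ENNReal.tsum_mul_right, ENNReal.tsum_mul_right,
    ENNReal.tsum_mul_left, hcs, PMF.tsum_coe, mul_one] at hsum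
  rw [ENNReal.ofReal_mul hc0]
  exact (ENNReal.add_le_add_iff_right
    (ENNReal.mul_ne_top ENNReal.ofReal_ne_top ENNReal.ofReal_ne_top)).1 hsum

/-- If conditioning on `Y` leaves no uncertainty about `X`, then `Y` determines `X`. -/
theorem eq_of_condEntropy_eq_zero {b : ℝ} (hb : 1 < b) {p : PMF Ω} {X : Ω → α} {Y : Ω → β}
    (h : condEntropy b p X Y = 0) {ω ω' : Ω} (hω : ω ∈ p.support) (hω' : ω' ∈ p.support)
    (hY : Y ω = Y ω') : X ω = X ω' := by
  classical
  by_contra hne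
  set J := p.map fun ω => (X ω, Y ω) with hJ
  have hpos : ∀ {ω}, ω ∈ p.support → J (X ω, Y ω) ≠ 0 := fun {ω} hω => by
    rw [← PMF.mem_support_iff, hJ, PMF.mem_support_map_iff]
    exact ⟨ω, hω, rfl⟩
  have h1 := hpos hω
  have h2 := hpos hω'
  rw [← hY] at h2
  -- Two values of `X` share the mass of one value of `Y`, so the entropy term at the first has a
  -- ratio above 1 and is positive.
  have hle : J (X ω, Y ω) + J (X ω', Y ω) ≤ p.map Y (Y ω) := by
    rw [map_snd_apply p X Y, ← Finset.sum_pair hne (f := fun x => J (x, Y ω))]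
    exact ENNReal.sum_le_tsum _
  have hterm := ENNReal.tsum_eq_zero.1 h (X ω, Y ω)
  rw [ENNReal.ofReal_eq_zero] at hterm
  have hJpos : 0 < (J (X ω, Y ω)).toReal := ENNReal.toReal_pos h1 (PMF.apply_ne_top _ _)
  have hJpos' : 0 < (J (X ω', Y ω)).toReal := ENNReal.toReal_pos h2 (PMF.apply_ne_top _ _)
  have hle' := ENNReal.toReal_mono (PMF.apply_ne_top _ _) hle
  rw [ENNReal.toReal_add (PMF.apply_ne_top _ _) (PMF.apply_ne_top _ _)] at hle'
  refine absurd hterm (not_le.2 (mul_pos hJpos (Real.logb_pos hb ?_)))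
  rw [one_lt_div hJpos]
  linarith

open Classical in
theorem uniform_map_apply [Fintype Ω] [Nonempty Ω] (f : Ω → α) (a : α) :
    (PMF.uniformOfFintype Ω).map f a =
      ((Finset.univ.filter fun ω => f ω = a).card : ℝ≥0∞) * (Fintype.card Ω : ℝ≥0∞)⁻¹ := by
  simp only [PMF.map_apply, PMF.uniformOfFintype_apply, tsum_fintype]
  rw [← Finset.sum_filter, Finset.sum_const, nsmul_eq_mul]
  simp only [eq_comm]

/-- The conditional entropy of a function of `Q` and of independent uniform data given `Q` is the
mean of the entropies for the single values of `Q`. -/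
theorem tsum_relEntropy_le [Fintype Ω] [Nonempty Ω] {b : ℝ} (hb : 1 < b) (p : PMF β)
    (A : β → Ω → α) (J : PMF (α × β))
    (hJ : J = p.bind fun x => (PMF.uniformOfFintype Ω).map fun w => (A x w, x)) :
    ∑' x, p x * ENNReal.ofReal (relEntropy b fun w w' => A x w' = A x w) ≤
      ∑' z : α × β, ENNReal.ofReal ((J z).toReal * Real.logb b ((p z.2).toReal / (J z).toReal)) := by
  classical
  have hn : (0 : ℝ) < Fintype.card Ω := by exact_mod_cast Fintype.card_pos
  have hJa : ∀ a x, (J (a, x)).toReal = (p x).toReal *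
      (((Finset.univ.filter fun w => A x w = a).card : ℝ) / Fintype.card Ω) := by
    intro a x
    rw [hJ, PMF.bind_apply, tsum_eq_single x, uniform_map_apply]
    · simp only [Prod.mk.injEq, and_true, ENNReal.toReal_mul, ENNReal.toReal_natCast,
        ENNReal.toReal_inv, div_eq_mul_inv]
    · intro x' hx'
      rw [uniform_map_apply]
      simp [hx']
  rw [ENNReal.tsum_prod', ENNReal.tsum_comm]
  refine ENNReal.tsum_le_tsum fun x => ?_
  rcases eq_or_ne (p x) 0 with h0 | h0
  · simp [h0]
  have hp : 0 < (p x).toReal := ENNReal.toReal_pos h0 (PMF.apply_ne_top _ _)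
  -- Only attained answers matter; they form a finite set, and on it the terms regroup into a sum
  -- over Ω.
  refine le_trans ?_ (ENNReal.sum_le_tsum (Finset.univ.image (A x)))
  set N : α → ℝ := fun a => ((Finset.univ.filter fun w => A x w = a).card : ℝ) with hN
  have hterm : ∀ a ∈ Finset.univ.image (A x), ENNReal.ofReal
      ((J (a, x)).toReal * Real.logb b ((p x).toReal / (J (a, x)).toReal)) =
      p x * ENNReal.ofReal ((Finset.univ.filter fun w => A x w = a).card •
        (Real.logb b (Fintype.card Ω / N a) / Fintype.card Ω)) := by
    intro a ha
    obtain ⟨w, -, hw⟩ := Finset.mem_image.1 ha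
    have hNa : 0 < N a := by
      have : (Finset.univ.filter fun w => A x w = a).Nonempty := ⟨w, by simp [hw]⟩
      simpa [hN] using this
    rw [hJa, ← ofReal_toReal_apply p x, ← ENNReal.ofReal_mul hp.le, ofReal_toReal_apply]
    congr 1
    change (p x).toReal * (N a / _) * Real.logb b ((p x).toReal / ((p x).toReal * (N a / _))) = _
    rw [show (p x).toReal / ((p x).toReal * (N a / (Fintype.card Ω : ℝ))) =
      Fintype.card Ω / N a by field_simp, nsmul_eq_mul]
    ring
  rw [Finset.sum_congr rfl hterm, ← Finset.mul_sum]
  refine mul_le_mul_right ?_ _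
  rw [← ENNReal.ofReal_sum_of_nonneg]
  · refine ENNReal.ofReal_le_ofReal (le_of_eq ?_)
    rw [← Finset.sum_comp (fun a => Real.logb b (Fintype.card Ω / N a) / Fintype.card Ω) (A x)]
    unfold relEntropy
    rw [Finset.sum_div]
    refine Finset.sum_congr rfl fun w _ => ?_
    simp only [fiberCard, hN]
  · intro a ha
    obtain ⟨w, -, hw⟩ := Finset.mem_image.1 ha
    have hNa : 0 < N a := by
      have : (Finset.univ.filter fun w => A x w = a).Nonempty := ⟨w, by simp [hw]⟩
      simpa [hN] using this
    have hNn : N a ≤ Fintype.card Ω := by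
      simp only [hN]
      exact_mod_cast Finset.card_le_univ _
    exact nsmul_nonneg (div_nonneg (Real.logb_nonneg hb ((one_le_div hNa).2 hNn)) hn.le) _

end PMFLemmas

/-! ### From protocols to polymatroids, and averaging over queries -/

namespace Protocol

variable {V : Type} {G : SimpleGraph V} (P : Protocol G)

theorem one_lt_base : 1 < P.base := by
  unfold base
  exact_mod_cast Finite.one_lt_card

variable [Finite V]

noncomputable instance : Fintype P.Files := Fintype.ofFinite _

/-- The answer of a server as a function of its query and all files. -/
def reply (v : V) (x : P.Query v) (w : P.Files) : P.Answer v := P.answer v x fun e => w e.1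

theorem law_map {α : Type} (θ : G.edgeSet) (f : P.Outcome → α) :
    (P.law θ).map f =
      (P.queryLaw θ).bind fun q => (PMF.uniformOfFintype P.Files).map fun w => f (q, w) := by
  unfold law
  rw [PMF.map_bind]
  simp only [PMF.map_comp]
  rfl

theorem law_map_query (θ : G.edgeSet) (v : V) :
    (P.law θ).map (P.query v) = (P.queryLaw θ).map fun q => q v := by
  rw [law_map]
  exact congrArg _ (funext fun q => PMF.map_const _ _)

theorem law_map_ans_query (θ : G.edgeSet) (v : V) :
    (P.law θ).map (fun ω => (P.ans v ω, P.query v ω)) =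
      ((P.queryLaw θ).map fun q => q v).bind fun x =>
        (PMF.uniformOfFintype P.Files).map fun w => (P.reply v x w, x) := by
  rw [law_map, PMF.bind_map]
  rfl

theorem mem_support_law {θ : G.edgeSet} {q : (v : V) → P.Query v} (hq : q ∈ (P.queryLaw θ).support)
    (w : P.Files) : (q, w) ∈ (P.law θ).support := by
  have h := P.law_map θ id
  rw [PMF.map_id] at h
  rw [h, PMF.mem_support_bind_iff]
  refine ⟨q, hq, ?_⟩
  rw [PMF.mem_support_map_iff]
  exact ⟨w, PMF.mem_support_uniformOfFintype _, rfl⟩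

theorem Reliable.decodes {P : Protocol G} (hP : P.Reliable) {θ : G.edgeSet}
    {q : (v : V) → P.Query v} (hq : q ∈ (P.queryLaw θ).support) {w w' : P.Files}
    (h : ∀ v, P.reply v (q v) w = P.reply v (q v) w') : w θ = w' θ :=
  eq_of_condEntropy_eq_zero P.one_lt_base (hP θ) (P.mem_support_law hq w)
    (P.mem_support_law hq w') (Prod.ext (funext h) rfl)

/-- The only consequence of privacy that the bound needs: with the query fixed, the answer entropy
does not involve θ. -/
theorem Private.map_query_eq {P : Protocol G} (hP : P.Private) (v : V) (θ θ' : G.edgeSet) :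
    ((P.queryLaw θ).map fun q => q v) = (P.queryLaw θ').map fun q => q v := by
  have h := congrArg (PMF.map Prod.fst) (hP v θ θ')
  rw [PMF.map_comp, PMF.map_comp] at h
  rw [← law_map_query, ← law_map_query]
  exact h

/-- The answer entropy of the server `v` at the query `x`, given the files in `U`. -/
noncomputable def replyEntropy (v : V) (x : P.Query v) (U : Set G.edgeSet) : ℝ :=
  relEntropy P.base (fun w w' : P.Files =>
    (∀ e ∈ U, w' e = w e) ∧ P.reply v x w' = P.reply v x w) - P.L * U.ncard

/-- The mean answer entropy of the server `v`, given its query and the files in `U`. -/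
noncomputable def meanEntropy (θ : G.edgeSet) (v : V) (U : Set G.edgeSet) : ℝ≥0∞ :=
  ∑' x, ((P.queryLaw θ).map fun q => q v) x * ENNReal.ofReal (P.replyEntropy v x U)

/-- Passing from the law of one query to the joint law puts the terms of all servers under a single
average. -/
theorem meanEntropy_eq_tsum (θ : G.edgeSet) (v : V) (U : Set G.edgeSet) :
    P.meanEntropy θ v U =
      ∑' q, P.queryLaw θ q * ENNReal.ofReal (P.replyEntropy v (q v) U) :=
  tsum_map_mul _ _ _

theorem Private.meanEntropy_eq {P : Protocol G} (hP : P.Private) (θ θ' : G.edgeSet) (v : V)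
    (U : Set G.edgeSet) : P.meanEntropy θ v U = P.meanEntropy θ' v U := by
  unfold meanEntropy
  rw [hP.map_query_eq v θ θ']

theorem meanEntropy_empty_le (θ : G.edgeSet) (v : V) :
    P.meanEntropy θ v ∅ ≤ condEntropy P.base (P.law θ) (P.ans v) (P.query v) := by
  have h := tsum_relEntropy_le P.one_lt_base ((P.queryLaw θ).map fun q => q v) (P.reply v) _
    (P.law_map_ans_query θ v)
  rw [← P.law_map_query] at h
  have h0 : ∀ x, P.replyEntropy v x ∅ =
      relEntropy P.base fun w w' : P.Files => P.reply v x w' = P.reply v x w := fun x => by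
    simp [replyEntropy]
  unfold meanEntropy
  simp only [h0]
  rw [← P.law_map_query]
  exact h

/-- The values of files and answers. -/
abbrev Value : G.edgeSet ⊕ V → Type := Sum.elim (fun _ => Fin P.L → P.F) P.Answer

/-- The files and, for fixed queries, the answers as functions of the contents of all files. -/
def values (q : (v : V) → P.Query v) : (x : G.edgeSet ⊕ V) → P.Files → P.Value x
  | Sum.inl e => fun w => w e
  | Sum.inr v => fun w => P.reply v (q v) w

theorem relEntropy_files (U : Set G.edgeSet) :
    relEntropy P.base (fun w w' : P.Files => ∀ e ∈ U, w' e = w e) = P.L * U.ncard := by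
  let _ : Fintype (Fin P.L → P.F) := Fintype.ofFinite _
  have h := relEntropy_eqOn (E := G.edgeSet) (X := Fin P.L → P.F) (b := P.base) U
  have hb := P.one_lt_base
  have h2 : ((Fintype.card (Fin P.L → P.F) : ℕ) : ℝ) = P.base ^ P.L := by
    rw [← Nat.card_eq_fintype_card, Nat.card_fun, Nat.card_fin]
    push_cast
    rfl
  rw [h2, Real.logb_pow, Real.logb_self_eq_one hb, mul_one] at h
  exact h

/-- The polymatroid of files and answers for fixed queries. -/
noncomputable def polymatroid (q : (v : V) → P.Query v) :
    StoragePolymatroid (fun v : V => {e : G.edgeSet | v ∈ e.1}) (P.L : ℝ) where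
  rank S := relEntropy P.base (agree (P.values q) S)
  mono h := relEntropy_agree_mono _ P.one_lt_base h
  submodular S T := relEntropy_agree_submodular _ P.one_lt_base S T
  rank_files U := by
    rw [← P.relEntropy_files]
    congr 1
    ext w w'
    refine ⟨fun g e he => g (Sum.inl e) ⟨e, he, rfl⟩, ?_⟩
    rintro g _ ⟨e, he, rfl⟩
    exact g e he
  determined {S T} hST h := by
    congr 1
    ext w w'
    refine ⟨fun g x hx => g x (hST hx), fun g x hx => ?_⟩
    rcases h x hx with hx | ⟨v, rfl, hv⟩
    · exact g x hx
    · change P.answer v (q v) _ = P.answer v (q v) _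
      congr 1
      ext1 e
      exact g (Sum.inl e.1) (hv ⟨e.1, e.2, rfl⟩)

/-- The right side sees only the query of `v`, so its mean depends only on the marginal law, to
which privacy applies. -/
theorem condRank_polymatroid (q : (v : V) → P.Query v) (v : V) (U : Set G.edgeSet) :
    (P.polymatroid q).condRank {v} U = P.replyEntropy v (q v) U := by
  unfold StoragePolymatroid.condRank replyEntropy
  rw [StoragePolymatroid.rank_files]
  congr 1
  change relEntropy _ _ = _
  congr 1
  ext w w'
  constructor
  · intro g
    exact ⟨fun e he => g (Sum.inl e) (Or.inl ⟨e, he, rfl⟩), g (Sum.inr v) (Or.inr ⟨v, rfl, rfl⟩)⟩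
  · rintro ⟨g1, g2⟩ x (⟨e, he, rfl⟩ | ⟨u, rfl, rfl⟩)
    · exact g1 e he
    · exact g2

theorem Reliable.rank_insert {P : Protocol G} (hP : P.Reliable) {θ : G.edgeSet}
    {q : (v : V) → P.Query v} (hq : q ∈ (P.queryLaw θ).support) (S : Set (G.edgeSet ⊕ V))
    (hS : ∀ v, Sum.inr v ∈ S) :
    (P.polymatroid q).rank (insert (Sum.inl θ) S) = (P.polymatroid q).rank S := by
  change relEntropy _ _ = relEntropy _ _
  congr 1
  ext w w'
  refine ⟨fun g x hx => g x (Or.inr hx), ?_⟩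
  rintro g x (rfl | hx)
  · exact hP.decodes hq fun v => g (Sum.inr v) (hS v)
  · exact g x hx

theorem mean_grid_inequality {P : Protocol G} (hR : P.Reliable) (hP : P.Private) (θ₀ : G.edgeSet)
    {m : ℕ} {a b : ℕ → V} {p q : G.edgeSet → ℕ}
    (ha : ∀ i < m, ∀ e, a i ∈ e.1 ↔ p e = i) (hb : ∀ i < m, ∀ e, b i ∈ e.1 ↔ q e = i)
    (hai : ∀ i < m, ∀ j < m, a i = a j → i = j) (hbi : ∀ i < m, ∀ j < m, b i = b j → i = j)
    (hab : ∀ i j, a i ≠ b j) (hcover : ∀ v, ∃ i < m, v = a i ∨ v = b i)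
    {k : ℕ} (hk : k < m) {θ : G.edgeSet} (hθ : ∀ e, p e = k ∧ q e = k ↔ e = θ) :
    P.L + ∑ i ∈ Finset.range k, (P.meanEntropy θ₀ (a i) {e | i + 1 ≤ q e} +
        P.meanEntropy θ₀ (b i) {e | i ≤ p e}) +
        P.meanEntropy θ₀ (a k) {e | k ≤ q e} + P.meanEntropy θ₀ (b k) {e | k ≤ p e} ≤
      ∑ i ∈ Finset.range (k + 1), (P.meanEntropy θ₀ (a i) {e | k + 1 ≤ q e} +
        P.meanEntropy θ₀ (b i) {e | k + 1 ≤ p e}) := by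
  -- Privacy replaces the fixed θ₀ by the file θ that this inequality decodes; reliability then
  -- applies to every query tuple of positive probability.
  simp only [hP.meanEntropy_eq θ₀ θ, meanEntropy_eq_tsum]
  have hL : (P.L : ℝ≥0∞) = ∑' x, P.queryLaw θ x * (P.L : ℝ≥0∞) := by
    rw [ENNReal.tsum_mul_right, PMF.tsum_coe, one_mul]
  rw [hL]
  simp only [← ENNReal.tsum_add, ← Summable.tsum_finsetSum fun _ _ => ENNReal.summable, ← mul_add,
    ← Finset.mul_sum]
  refine ENNReal.tsum_le_tsum fun x => ?_
  by_cases hx : P.queryLaw θ x = 0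
  · simp [hx]
  refine mul_le_mul_right ?_ _
  have h := (P.polymatroid x).grid_inequality (m := m) (a := a) (b := b) (p := p) (q := q)
    (fun i hi => Set.ext (ha i hi)) (fun i hi => Set.ext (hb i hi)) hai hbi hab hcover hk hθ
    (hR.rank_insert ((PMF.mem_support_iff _ _).2 hx))
  have h0 : ∀ v U, 0 ≤ P.replyEntropy v (x v) U := fun v U => by
    rw [← condRank_polymatroid]
    exact StoragePolymatroid.condRank_nonneg _ _ _
  simp only [condRank_polymatroid] at h
  have h' := ENNReal.ofReal_le_ofReal h
  have h00 : ∀ v U v' U', 0 ≤ P.replyEntropy v (x v) U + P.replyEntropy v' (x v') U' :=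
    fun v U v' U' => add_nonneg (h0 v U) (h0 v' U')
  have hs : 0 ≤ ∑ i ∈ Finset.range k, (P.replyEntropy (a i) (x (a i)) {e | i + 1 ≤ q e} +
        P.replyEntropy (b i) (x (b i)) {e | i ≤ p e}) := Finset.sum_nonneg fun i _ => h00 _ _ _ _
  have hL0 : (0 : ℝ) ≤ P.L := Nat.cast_nonneg _
  rw [ENNReal.ofReal_add (by linarith [h0 (a k) {e | k ≤ q e}]) (h0 _ _),
    ENNReal.ofReal_add (by linarith) (h0 _ _), ENNReal.ofReal_add hL0 hs,
    ENNReal.ofReal_sum_of_nonneg fun i _ => h00 _ _ _ _,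
    ENNReal.ofReal_sum_of_nonneg fun i _ => h00 _ _ _ _, ENNReal.ofReal_natCast] at h'
  simpa only [ENNReal.ofReal_add (h0 _ _) (h0 _ _)] using h'

end Protocol

/-! ### The recursion and its solution -/

section Recursion

/-- The partial sums of the exponential series of `1 / 2`, without the constant term. -/
noncomputable def expSum (k : ℕ) : ℝ := ∑ i ∈ Finset.Icc 1 k, 1 / ((i ! : ℝ) * 2 ^ i)

theorem expSum_succ (k : ℕ) :
    expSum (k + 1) = expSum k + 1 / (((k + 1)! : ℝ) * 2 ^ (k + 1)) := by
  unfold expSum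
  rw [Finset.sum_Icc_succ_top (by omega)]

theorem expSum_nonneg (k : ℕ) : 0 ≤ expSum k := Finset.sum_nonneg fun _ _ => by positivity

/-- Subtracting consecutive instances leaves 2(k+2) d_{k+2} = d_{k+1} for the increments d, which
1/(k! 2^k) satisfies. -/
theorem expSum_recursion (k : ℕ) :
    1 + ∑ i ∈ Finset.range k, (expSum (i + 1) + expSum i) + 2 * expSum k =
      2 * (k + 1) * expSum (k + 1) := by
  induction k with
  | zero =>
    simp [expSum]
  | succ k ih =>
    rw [Finset.sum_range_succ, expSum_succ (k + 1)]
    have h1 := expSum_succ k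
    have h2 : 2 * ((k : ℝ) + 1 + 1) * (1 / (((k + 1 + 1)! : ℝ) * 2 ^ (k + 1 + 1))) =
        1 / (((k + 1)! : ℝ) * 2 ^ (k + 1)) := by
      rw [Nat.factorial_succ (k + 1), pow_succ 2 (k + 1)]
      push_cast
      field_simp
    push_cast
    rw [mul_add, h2]
    linarith

theorem le_of_expSum_recursion {F : ℕ → ℝ≥0∞} {m : ℕ} {c : ℝ} (hc : 0 ≤ c)
    (h : ∀ k < m, ENNReal.ofReal c + ∑ i ∈ Finset.range k, (F (i + 1) + F i) + 2 * F k ≤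
      2 * (k + 1) * F (k + 1)) (k : ℕ) (hk : k ≤ m) : ENNReal.ofReal (c * expSum k) ≤ F k := by
  induction k using Nat.strong_induction_on with
  | _ k ih =>
    cases k with
    | zero => simp [expSum]
    | succ k =>
      have hn : ∀ j, 0 ≤ c * expSum j := fun j => mul_nonneg hc (expSum_nonneg j)
      have h1 : ENNReal.ofReal (2 * (k + 1)) * ENNReal.ofReal (c * expSum (k + 1)) ≤
          ENNReal.ofReal (2 * (k + 1)) * F (k + 1) := by
        rw [← ENNReal.ofReal_mul (by positivity)]
        have e1 : 2 * ((k : ℝ) + 1) * (c * expSum (k + 1)) =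
            c + ∑ i ∈ Finset.range k, (c * expSum (i + 1) + c * expSum i) + 2 * (c * expSum k) := by
          simp only [← mul_add, ← Finset.mul_sum]
          linear_combination (-c) * expSum_recursion k
        have e2 : ENNReal.ofReal (2 * (k + 1)) = 2 * ((k : ℝ≥0∞) + 1) := by
          rw [ENNReal.ofReal_mul (by norm_num), ENNReal.ofReal_add (by positivity) zero_le_one]
          simp
        rw [e1, e2, ENNReal.ofReal_add (add_nonneg hc (Finset.sum_nonneg fun i _ =>
          add_nonneg (hn _) (hn _))) (mul_nonneg zero_le_two (hn _)),
          ENNReal.ofReal_add hc (Finset.sum_nonneg fun i _ => add_nonneg (hn _) (hn _)),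
          ENNReal.ofReal_sum_of_nonneg fun i _ => add_nonneg (hn _) (hn _),
          ENNReal.ofReal_mul (p := 2) zero_le_two]
        simp only [ENNReal.ofReal_add (hn _) (hn _), ENNReal.ofReal_ofNat]
        refine le_trans ?_ (h k (by omega))
        gcongr with i hi
        · exact ih (i + 1) (by have := Finset.mem_range.1 hi; omega)
            (by have := Finset.mem_range.1 hi; omega)
        · exact ih i (by have := Finset.mem_range.1 hi; omega)
            (by have := Finset.mem_range.1 hi; omega)
        · exact ih k (by omega) (by omega)
      exact (ENNReal.mul_le_mul_iff_right (ENNReal.ofReal_pos.2 (by positivity)).ne'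
        ENNReal.ofReal_ne_top).1 h1

end Recursion

/-! ### Averaging over the orderings of both sides -/

section Symmetrization

variable {m : ℕ} [NeZero m]

omit [NeZero m] in
theorem sum_perm_apply (f : Fin m → ℝ≥0∞) (x y : Fin m) :
    ∑ σ : Equiv.Perm (Fin m), f (σ x) = ∑ σ : Equiv.Perm (Fin m), f (σ y) := by
  rw [← Equiv.sum_comp (Equiv.mulRight (Equiv.swap x y))]
  simp

/-- The bound obtained by averaging the inequalities for all orderings of both sides of a complete
bipartite graph. -/
theorem le_sum_of_perm_inequalities (fA fB : Fin m → Equiv.Perm (Fin m) → ℕ → ℝ≥0∞)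
    (gA gB : Fin m → ℝ≥0∞) (L : ℕ) (hgA : ∀ x τ, fA x τ m = gA x) (hgB : ∀ y σ, fB y σ m = gB y)
    (hA : ∀ σ τ : Equiv.Perm (Fin m), ∀ k < m,
      L + ∑ i ∈ Finset.range k, (fA (σ (Fin.ofNat m i)) τ (i + 1) + fB (τ (Fin.ofNat m i)) σ i) +
        fA (σ (Fin.ofNat m k)) τ k + fB (τ (Fin.ofNat m k)) σ k ≤
      ∑ i ∈ Finset.range (k + 1),
        (fA (σ (Fin.ofNat m i)) τ (k + 1) + fB (τ (Fin.ofNat m i)) σ (k + 1)))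
    (hB : ∀ σ τ : Equiv.Perm (Fin m), ∀ k < m,
      L + ∑ i ∈ Finset.range k, (fB (τ (Fin.ofNat m i)) σ (i + 1) + fA (σ (Fin.ofNat m i)) τ i) +
        fB (τ (Fin.ofNat m k)) σ k + fA (σ (Fin.ofNat m k)) τ k ≤
      ∑ i ∈ Finset.range (k + 1),
        (fB (τ (Fin.ofNat m i)) σ (k + 1) + fA (σ (Fin.ofNat m i)) τ (k + 1))) :
    ENNReal.ofReal (2 * m * expSum m * L) ≤ ∑ x, gA x + ∑ y, gB y := by
  set M : ℕ := Fintype.card (Equiv.Perm (Fin m)) * Fintype.card (Equiv.Perm (Fin m)) with hM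
  have hM0 : 0 < M := by
    rw [hM]
    exact Nat.mul_pos Fintype.card_pos Fintype.card_pos
  set SA : ℕ → ℝ≥0∞ := fun j => ∑ σ : Equiv.Perm (Fin m), ∑ τ : Equiv.Perm (Fin m), fA (σ 0) τ j
    with hSA
  set SB : ℕ → ℝ≥0∞ := fun j => ∑ σ : Equiv.Perm (Fin m), ∑ τ : Equiv.Perm (Fin m), fB (τ 0) σ j
    with hSB
  have hSA' : ∀ x j, ∑ σ : Equiv.Perm (Fin m), ∑ τ : Equiv.Perm (Fin m), fA (σ x) τ j = SA j := by
    intro x j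
    exact Finset.sum_comm.trans ((Finset.sum_congr rfl fun τ _ =>
      sum_perm_apply (fun y => fA y τ j) x 0).trans Finset.sum_comm)
  have hSB' : ∀ x j, ∑ σ : Equiv.Perm (Fin m), ∑ τ : Equiv.Perm (Fin m), fB (τ x) σ j = SB j := by
    intro x j
    exact Finset.sum_congr rfl fun σ _ => sum_perm_apply (fun y => fB y σ j) x 0
  have hconst : ∑ σ : Equiv.Perm (Fin m), ∑ τ : Equiv.Perm (Fin m), (L : ℝ≥0∞) = M * L := by
    simp [hM, mul_assoc]
  have hA' : ∀ k < m, (M : ℝ≥0∞) * L + ∑ i ∈ Finset.range k, (SA (i + 1) + SB i) + SA k + SB k ≤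
      (k + 1) * (SA (k + 1) + SB (k + 1)) := by
    intro k hk
    have h := Finset.sum_le_sum fun σ (_ : σ ∈ Finset.univ) =>
      Finset.sum_le_sum fun τ (_ : τ ∈ Finset.univ) => hA σ τ k hk
    simp only [Finset.sum_add_distrib, Finset.sum_comm (t := Finset.range _), hSA', hSB',
      hconst] at h
    simp only [Finset.sum_const, Finset.card_range, nsmul_eq_mul] at h
    rw [mul_add, Finset.sum_add_distrib]
    exact_mod_cast h
  have hB' : ∀ k < m, (M : ℝ≥0∞) * L + ∑ i ∈ Finset.range k, (SB (i + 1) + SA i) + SB k + SA k ≤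
      (k + 1) * (SB (k + 1) + SA (k + 1)) := by
    intro k hk
    have h := Finset.sum_le_sum fun σ (_ : σ ∈ Finset.univ) =>
      Finset.sum_le_sum fun τ (_ : τ ∈ Finset.univ) => hB σ τ k hk
    simp only [Finset.sum_add_distrib, Finset.sum_comm (t := Finset.range _), hSA', hSB',
      hconst] at h
    simp only [Finset.sum_const, Finset.card_range, nsmul_eq_mul] at h
    rw [mul_add, Finset.sum_add_distrib]
    exact_mod_cast h
  -- Adding the two versions symmetrizes the roles of the sides, which differ through `i + 1` and
  -- `i`; each contributes `M * L` to the constant.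
  have hF := le_of_expSum_recursion (F := fun j => SA j + SB j) (m := m) (c := 2 * (M * L))
    (by positivity) (fun k hk => by
      have h := add_le_add (hA' k hk) (hB' k hk)
      rw [ENNReal.ofReal_mul zero_le_two, ENNReal.ofReal_mul (Nat.cast_nonneg _),
        ENNReal.ofReal_natCast, ENNReal.ofReal_natCast, ENNReal.ofReal_ofNat]
      simp only [Finset.sum_add_distrib] at h ⊢
      refine (le_of_eq ?_).trans (h.trans (le_of_eq ?_)) <;> ring) m le_rfl
  -- With all `m` files unknown the terms no longer depend on the other side's ordering, so the
  -- average over orderings is the average over servers.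
  have hend : (m : ℝ≥0∞) * (SA m + SB m) = M * (∑ x, gA x + ∑ y, gB y) := by
    have h1 : ∑ x : Fin m, SA m = M * ∑ x, gA x := by
      calc ∑ x : Fin m, SA m
          = ∑ x : Fin m, ∑ σ : Equiv.Perm (Fin m), ∑ τ : Equiv.Perm (Fin m), fA (σ x) τ m :=
            Finset.sum_congr rfl fun x _ => (hSA' x m).symm
        _ = ∑ σ : Equiv.Perm (Fin m), ∑ τ : Equiv.Perm (Fin m), ∑ x : Fin m, gA x := by
            simp only [hgA]
            rw [Finset.sum_comm]
            refine Finset.sum_congr rfl fun σ _ => ?_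
            rw [Finset.sum_comm]
            exact Finset.sum_congr rfl fun τ _ => Equiv.sum_comp σ gA
        _ = M * ∑ x, gA x := by simp [hM, mul_assoc]
    have h2 : ∑ x : Fin m, SB m = M * ∑ x, gB x := by
      calc ∑ x : Fin m, SB m
          = ∑ x : Fin m, ∑ σ : Equiv.Perm (Fin m), ∑ τ : Equiv.Perm (Fin m), fB (τ x) σ m :=
            Finset.sum_congr rfl fun x _ => (hSB' x m).symm
        _ = ∑ σ : Equiv.Perm (Fin m), ∑ τ : Equiv.Perm (Fin m), ∑ x : Fin m, gB x := by
            simp only [hgB]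
            rw [Finset.sum_comm]
            refine Finset.sum_congr rfl fun σ _ => ?_
            rw [Finset.sum_comm]
            exact Finset.sum_congr rfl fun τ _ => Equiv.sum_comp τ gB
        _ = M * ∑ x, gB x := by simp [hM, mul_assoc]
    rw [mul_add, mul_add, ← h1, ← h2]
    simp
  have hMpos : (M : ℝ≥0∞) ≠ 0 := by exact_mod_cast hM0.ne'
  refine (ENNReal.mul_le_mul_iff_right hMpos (ENNReal.natCast_ne_top M)).1 ?_
  rw [← hend, ← ENNReal.ofReal_natCast M, ← ENNReal.ofReal_mul (Nat.cast_nonneg _)]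
  refine le_trans (le_of_eq ?_) (mul_le_mul_right hF (m : ℝ≥0∞))
  rw [← ENNReal.ofReal_natCast m, ← ENNReal.ofReal_mul (Nat.cast_nonneg _)]
  congr 1
  ring

end Symmetrization

/-! ### Application to the complete bipartite graph -/

section Bipartite

variable {m : ℕ}

/-- The edges of a complete bipartite graph. -/
noncomputable def bipartiteEdge (m : ℕ) :
    Fin m × Fin m ≃ (completeBipartiteGraph (Fin m) (Fin m)).edgeSet :=
  Equiv.ofBijective (fun x => ⟨s(Sum.inl x.1, Sum.inr x.2), by simp⟩) (by
    constructor
    · rintro ⟨a, b⟩ ⟨a', b'⟩ h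
      simpa using h
    · rintro ⟨e, he⟩
      induction e with
      | _ u v =>
        rcases u with u | u <;> rcases v with v | v
        · simp at he
        · exact ⟨(u, v), rfl⟩
        · exact ⟨(v, u), Subtype.ext Sym2.eq_swap⟩
        · simp at he)

theorem inl_mem_bipartiteEdge (x : Fin m × Fin m) (i : Fin m) :
    Sum.inl i ∈ (bipartiteEdge m x).1 ↔ i = x.1 := by
  change Sum.inl i ∈ s(Sum.inl x.1, Sum.inr x.2) ↔ _
  simp

theorem inr_mem_bipartiteEdge (x : Fin m × Fin m) (i : Fin m) :
    Sum.inr i ∈ (bipartiteEdge m x).1 ↔ i = x.2 := by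
  change Sum.inr i ∈ s(Sum.inl x.1, Sum.inr x.2) ↔ _
  simp

variable [NeZero m]

/-- `Fin.ofNat m i` is `i` modulo `m`, hence the restriction to `i < m`. -/
theorem perm_ofNat_eq_iff (σ : Equiv.Perm (Fin m)) {i : ℕ} (hi : i < m) (x : Fin m) :
    σ (Fin.ofNat m i) = x ↔ (σ.symm x).val = i := by
  rw [← Equiv.eq_symm_apply, Fin.ext_iff, Fin.val_ofNat, Nat.mod_eq_of_lt hi, eq_comm]

theorem perm_ofNat_inj (σ : Equiv.Perm (Fin m)) {i j : ℕ} (hi : i < m) (hj : j < m)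
    (h : σ (Fin.ofNat m i) = σ (Fin.ofNat m j)) : i = j := by
  rw [perm_ofNat_eq_iff σ hi, Equiv.symm_apply_apply, Fin.val_ofNat, Nat.mod_eq_of_lt hj] at h
  exact h.symm

theorem exists_perm_ofNat_eq (σ : Equiv.Perm (Fin m)) (x : Fin m) :
    ∃ i < m, x = σ (Fin.ofNat m i) :=
  ⟨(σ.symm x).val, (σ.symm x).isLt, ((perm_ofNat_eq_iff σ (σ.symm x).isLt x).2 rfl).symm⟩

theorem Protocol.le_sum_condEntropy {P : Protocol (completeBipartiteGraph (Fin m) (Fin m))}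
    (hR : P.Reliable) (hP : P.Private)
    (θ₀ : (completeBipartiteGraph (Fin m) (Fin m)).edgeSet) :
    ENNReal.ofReal (2 * m * expSum m * P.L) ≤
      ∑ v, condEntropy P.base (P.law θ₀) (P.ans v) (P.query v) := by
  refine le_trans ?_ (Finset.sum_le_sum fun v _ => P.meanEntropy_empty_le θ₀ v)
  rw [Fintype.sum_sum_type]
  set row : Equiv.Perm (Fin m) → (completeBipartiteGraph (Fin m) (Fin m)).edgeSet → ℕ :=
    fun σ e => (σ.symm ((bipartiteEdge m).symm e).1).val with hrow
  set col : Equiv.Perm (Fin m) → (completeBipartiteGraph (Fin m) (Fin m)).edgeSet → ℕ :=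
    fun τ e => (τ.symm ((bipartiteEdge m).symm e).2).val with hcol
  have hrowlt : ∀ σ e, ¬ m ≤ row σ e := fun σ e => not_le.2 (Fin.isLt _)
  have hcollt : ∀ σ e, ¬ m ≤ col σ e := fun σ e => not_le.2 (Fin.isLt _)
  have ha : ∀ σ : Equiv.Perm (Fin m), ∀ i < m,
      ∀ e : (completeBipartiteGraph (Fin m) (Fin m)).edgeSet,
      (Sum.inl (σ (Fin.ofNat m i)) : Fin m ⊕ Fin m) ∈ e.1 ↔ row σ e = i := by
    intro σ i hi e
    obtain ⟨x, rfl⟩ := (bipartiteEdge m).surjective e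
    rw [inl_mem_bipartiteEdge, perm_ofNat_eq_iff σ hi]
    simp [hrow]
  have hb : ∀ τ : Equiv.Perm (Fin m), ∀ i < m,
      ∀ e : (completeBipartiteGraph (Fin m) (Fin m)).edgeSet,
      (Sum.inr (τ (Fin.ofNat m i)) : Fin m ⊕ Fin m) ∈ e.1 ↔ col τ e = i := by
    intro τ i hi e
    obtain ⟨x, rfl⟩ := (bipartiteEdge m).surjective e
    rw [inr_mem_bipartiteEdge, perm_ofNat_eq_iff τ hi]
    simp [hcol]
  have hθ : ∀ σ τ : Equiv.Perm (Fin m), ∀ k < m, ∀ e, row σ e = k ∧ col τ e = k ↔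
      e = bipartiteEdge m (σ (Fin.ofNat m k), τ (Fin.ofNat m k)) := by
    intro σ τ k hk e
    obtain ⟨x, rfl⟩ := (bipartiteEdge m).surjective e
    rw [(bipartiteEdge m).injective.eq_iff, Prod.ext_iff, eq_comm (a := x.1), eq_comm (a := x.2),
      perm_ofNat_eq_iff σ hk, perm_ofNat_eq_iff τ hk]
    simp [hrow, hcol]
  refine le_sum_of_perm_inequalities
    (fun x τ j => P.meanEntropy θ₀ (Sum.inl x) {e | j ≤ col τ e})
    (fun y σ j => P.meanEntropy θ₀ (Sum.inr y) {e | j ≤ row σ e}) _ _ P.L ?_ ?_ ?_ ?_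
  -- No index reaches `m`, so the set of known files is empty at level `m`.
  · intro x τ
    simp [hcollt]
  · intro y σ
    simp [hrowlt]
  · intro σ τ k hk
    refine Protocol.mean_grid_inequality hR hP θ₀ (m := m) (a := fun i => Sum.inl (σ (Fin.ofNat m i)))
      (b := fun i => Sum.inr (τ (Fin.ofNat m i))) (p := row σ) (q := col τ) (ha σ) (hb τ)
      (fun i hi j hj h => perm_ofNat_inj σ hi hj (Sum.inl_injective h))
      (fun i hi j hj h => perm_ofNat_inj τ hi hj (Sum.inr_injective h))
      (fun i j h => by simp at h) ?_ hk (hθ σ τ k hk)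
    rintro (x | x)
    · obtain ⟨i, hi, rfl⟩ := exists_perm_ofNat_eq σ x
      exact ⟨i, hi, Or.inl rfl⟩
    · obtain ⟨i, hi, rfl⟩ := exists_perm_ofNat_eq τ x
      exact ⟨i, hi, Or.inr rfl⟩
  -- The same inequality with the two sides exchanged, so that the right side's server is peeled off
  -- first.
  · intro σ τ k hk
    refine Protocol.mean_grid_inequality hR hP θ₀ (m := m) (b := fun i => Sum.inl (σ (Fin.ofNat m i)))
      (a := fun i => Sum.inr (τ (Fin.ofNat m i))) (q := row σ) (p := col τ) (hb τ) (ha σ)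
      (fun i hi j hj h => perm_ofNat_inj τ hi hj (Sum.inr_injective h))
      (fun i hi j hj h => perm_ofNat_inj σ hi hj (Sum.inl_injective h))
      (fun i j h => by simp at h) ?_ hk (fun e => and_comm.trans (hθ σ τ k hk e))
    rintro (x | x)
    · obtain ⟨i, hi, rfl⟩ := exists_perm_ofNat_eq σ x
      exact ⟨i, hi, Or.inr rfl⟩
    · obtain ⟨i, hi, rfl⟩ := exists_perm_ofNat_eq τ x
      exact ⟨i, hi, Or.inl rfl⟩

theorem condCapacity_completeBipartiteGraph_le :
    condCapacity (completeBipartiteGraph (Fin m) (Fin m)) ≤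
      ENNReal.ofReal ((1 / expSum m) * (1 / (2 * m : ℝ))) := by
  refine iSup₂_le fun S θ => ?_
  have hm : (0 : ℝ) < m := by exact_mod_cast NeZero.pos m
  have hL : (0 : ℝ) < S.L := by exact_mod_cast S.L_pos
  have he : 0 < expSum m :=
    Finset.sum_pos (fun _ _ => by positivity) ⟨1, Finset.mem_Icc.2 ⟨le_rfl, NeZero.pos m⟩⟩
  refine (ENNReal.div_le_div_left
    (Protocol.le_sum_condEntropy S.reliable S.isPrivate θ) _).trans (le_of_eq ?_)
  rw [← ENNReal.ofReal_natCast S.L, ← ENNReal.ofReal_div_of_pos (by positivity)]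
  congr 1
  field_simp

end Bipartite

/-- Conditioning on the query lowers each answer entropy and so raises the rate; a bound for the
conditioned capacity covers both. -/
theorem capacity_le_condCapacity {V : Type} [Fintype V] (G : SimpleGraph V) :
    capacity G ≤ condCapacity G :=
  iSup₂_mono fun S _ => ENNReal.div_le_div_left
    (Finset.sum_le_sum fun _ _ => condEntropy_le_entropy S.one_lt_base _ _ _) _

theorem tendsto_expSum : Tendsto expSum atTop (𝓝 (Real.exp (1 / 2) - 1)) := by
  have h := (NormedSpace.expSeries_div_hasSum_exp (1 / 2 : ℝ)).tendsto_sum_nat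
  rw [← Real.exp_eq_exp_ℝ] at h
  have h1 := ((tendsto_add_atTop_iff_nat 1).2 h).sub_const 1
  refine h1.congr fun k => ?_
  induction k with
  | zero => simp [expSum]
  | succ k ih =>
    rw [expSum_succ, ← ih, Finset.sum_range_succ _ (k + 1)]
    have : (1 / 2 : ℝ) ^ (k + 1) / ((k + 1)! : ℝ) = 1 / (((k + 1)! : ℝ) * 2 ^ (k + 1)) := by
      rw [one_div_pow, div_div, mul_comm]
    rw [this]
    ring

end PIR

/-! ### The bound, its comparison with 2/N, and the limit -/

theorem mainTheorem2 :
    (∀ N : ℕ, Even N → 4 ≤ N →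
      PIR.capacity (completeBipartiteGraph (Fin (N / 2)) (Fin (N / 2))) ≤
          ENNReal.ofReal
            ((1 / ∑ i ∈ Finset.Icc 1 (N / 2), 1 / ((i ! : ℝ) * 2 ^ i)) * (1 / (N : ℝ))) ∧
      PIR.condCapacity (completeBipartiteGraph (Fin (N / 2)) (Fin (N / 2))) ≤
          ENNReal.ofReal
            ((1 / ∑ i ∈ Finset.Icc 1 (N / 2), 1 / ((i ! : ℝ) * 2 ^ i)) * (1 / (N : ℝ))) ∧
      (1 / ∑ i ∈ Finset.Icc 1 (N / 2), 1 / ((i ! : ℝ) * 2 ^ i)) * (1 / (N : ℝ)) <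
          2 / (N : ℝ)) ∧
    Tendsto (fun m : ℕ => 1 / ∑ i ∈ Finset.Icc 1 m, 1 / ((i ! : ℝ) * 2 ^ i)) atTop
      (𝓝 (1 / (Real.exp (1 / 2) - 1))) ∧
    |1 / (Real.exp (1 / 2) - 1) - 1.5415| < 0.00005 := by
  -- Squaring reduces both bounds to decimal bounds for e; five decimals keep the reciprocal within
  -- the tolerance.
  have hlow : 1.64872 < Real.exp (1 / 2) := by
    refine lt_of_pow_lt_pow_left₀ 2 (Real.exp_pos _).le ?_
    rw [← Real.exp_nat_mul]
    norm_num
    linarith [Real.exp_one_gt_d9]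
  have hupp : Real.exp (1 / 2) < 1.64873 := by
    refine lt_of_pow_lt_pow_left₀ 2 (by norm_num) ?_
    rw [← Real.exp_nat_mul]
    norm_num
    linarith [Real.exp_one_lt_d9]
  refine ⟨?_, ?_, ?_⟩
  · rintro N ⟨m, rfl⟩ hN
    have hm : (m + m) / 2 = m := by omega
    rw [hm]
    have : NeZero m := ⟨by omega⟩
    have h := PIR.condCapacity_completeBipartiteGraph_le (m := m)
    rw [two_mul, ← Nat.cast_add] at h
    refine ⟨(PIR.capacity_le_condCapacity _).trans h, h, ?_⟩
    have hpos : (0 : ℝ) < ((m + m : ℕ) : ℝ) := by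
      exact_mod_cast (by omega : 0 < m + m)
    have hsum : (1 / 2 : ℝ) < ∑ i ∈ Finset.Icc 1 m, 1 / ((i ! : ℝ) * 2 ^ i) := by
      -- The first term alone is exactly 1/2; strictness needs the second term, hence `N ≥ 4`.
      calc (1 / 2 : ℝ) < ∑ i ∈ Finset.Icc 1 2, 1 / ((i ! : ℝ) * 2 ^ i) := by
            norm_num [Finset.sum_Icc_succ_top, Nat.factorial]
        _ ≤ _ := Finset.sum_le_sum_of_subset_of_nonneg
            (Finset.Icc_subset_Icc_right (by omega)) fun _ _ _ => by positivity
    rw [mul_one_div]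
    refine div_lt_div_of_pos_right ?_ hpos
    rw [div_lt_iff₀ (by linarith)]
    linarith
  · exact tendsto_const_nhds.div PIR.tendsto_expSum (sub_pos.2 (by linarith)).ne'
  · have hpos : 0 < Real.exp (1 / 2) - 1 := by linarith
    rw [abs_lt]
    constructor
    · rw [lt_sub_iff_add_lt, lt_div_iff₀ hpos]
      linarith
    · rw [sub_lt_iff_lt_add, div_lt_iff₀ hpos]
      linarith
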